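/- Let $X$ be a real or complex Hilbert space, let $M$ and $N$ be closed subspaces of $X$, and put $M_1=M\ominus(M\cap N)$ and $N_1=N\ominus(M\cap N)$ (orthogonal complements of $M\cap N$ in $M$ and in $N$). A closed subspace $K$ of $X$ is a common complement of $M$ and $N$ if $M\cap K=N\cap K=\{0\}$ and $M+K=N+K=X$ (algebraic sums). Two unordered pairs of closed subspaces of two Hilbert spaces are unitarily equivalent if a linear isometry of the first space onto the second takes the first pair to the second. For a bounded linear operator $T:X_1\to X_2$ between Hilbert spaces, $\mathrm{Gr}(T)=\{(x,Tx):x\in X_1\}$ is its graph in the Hilbert space direct sum $X_1\oplus X_2$. Then the following are equivalent: 1. $M^{\perp}$ is a common complement of $M$ and $N$ in $X$. 2. There exist Hilbert spaces $X_1,X_2$ and a bounded linear operator $T:X_1\to X_2$ with $I-T^*T$ injective and $I-TT^*$ onto such that $\{M,N\}$ is unitarily equivalent to $\{\mathrm{Gr}(-T),\mathrm{Gr}(T)\}$. 3. There exist Hilbert spaces $X_1,X_2$ and an injective bounded linear operator $T:X_1\to X_2$ with $I-T^*T$ injective and $I-TT^*$ onto such that the pair $\{M_1,N_1\}$ of subspaces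 of $X$ is unitarily equivalent to $\{\mathrm{Gr}(-T),\mathrm{Gr}(T)\}$. 4. There exist Hilbert spaces $Y_1,Y_2$ and a bounded linear operator $S:Y_1\to Y_2$ such that $\{M,N\}$ is unitarily equivalent to $\{Y_1\oplus\{0\},\mathrm{Gr}(S)\}$. Moreover, there is a representation of $\{M,N\}$ as in 2 with $T$ injective if and only if $M^{\perp}$ is a common complement of $M$ and $N$ and $M\cap N=\{0\}$. -/

import Mathlib

namespace CommonComplement

universe u v

/-- `K` is a common (algebraic) complement of `M` and `N`: `K` is closed,
`M ∩ K = N ∩ K = {0}` and `M + K = N + K = X` (algebraic sums). -/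
def IsCommonComplement {𝕜 : Type*} [RCLike 𝕜] {X : Type*} [NormedAddCommGroup X]
    [InnerProductSpace 𝕜 X] (K M N : Submodule 𝕜 X) : Prop :=
  IsClosed (K : Set X) ∧ IsCompl M K ∧ IsCompl N K

/-- The unordered pairs `{M, N}` and `{A, B}` of subspaces are unitarily equivalent: some
surjective linear isometry takes the one unordered pair to the other. -/
def UnitarilyEquivalentPairs {𝕜 : Type*} [RCLike 𝕜] {X Y : Type*}
    [NormedAddCommGroup X] [InnerProductSpace 𝕜 X]
    [NormedAddCommGroup Y] [InnerProductSpace 𝕜 Y]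
    (M N : Submodule 𝕜 X) (A B : Submodule 𝕜 Y) : Prop :=
  ∃ U : X ≃ₗᵢ[𝕜] Y,
    (M.map (U.toLinearEquiv : X →ₗ[𝕜] Y) = A ∧ N.map (U.toLinearEquiv : X →ₗ[𝕜] Y) = B) ∨
    (M.map (U.toLinearEquiv : X →ₗ[𝕜] Y) = B ∧ N.map (U.toLinearEquiv : X →ₗ[𝕜] Y) = A)

/-- The graph `Gr(T) = {(x, T x)}` as a subspace of the Hilbert space direct sum `X₁ ⊕ X₂`,
which is `WithLp 2 (X₁ × X₂)`. -/
def Gr {𝕜 : Type*} [RCLike 𝕜] {X₁ X₂ : Type*}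
    [NormedAddCommGroup X₁] [InnerProductSpace 𝕜 X₁]
    [NormedAddCommGroup X₂] [InnerProductSpace 𝕜 X₂]
    (T : X₁ →L[𝕜] X₂) : Submodule 𝕜 (WithLp 2 (X₁ × X₂)) :=
  (LinearMap.graph (T : X₁ →ₗ[𝕜] X₂)).comap
    (WithLp.linearEquiv 2 𝕜 (X₁ × X₂) : WithLp 2 (X₁ × X₂) →ₗ[𝕜] X₁ × X₂)

/-- The subspace `Y₁ ⊕ {0}` of the Hilbert space direct sum `Y₁ ⊕ Y₂`. -/
def firstSummand (𝕜 : Type*) [RCLike 𝕜] (Y₁ Y₂ : Type*)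
    [NormedAddCommGroup Y₁] [InnerProductSpace 𝕜 Y₁]
    [NormedAddCommGroup Y₂] [InnerProductSpace 𝕜 Y₂] :
    Submodule 𝕜 (WithLp 2 (Y₁ × Y₂)) :=
  ((⊤ : Submodule 𝕜 Y₁).prod (⊥ : Submodule 𝕜 Y₂)).comap
    (WithLp.linearEquiv 2 𝕜 (Y₁ × Y₂) : WithLp 2 (Y₁ × Y₂) →ₗ[𝕜] Y₁ × Y₂)

/-- `M ⊖ L`, the orthogonal complement of `L` in `M`. -/
def orthoDiff {𝕜 : Type*} [RCLike 𝕜] {X : Type*} [NormedAddCommGroup X]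
    [InnerProductSpace 𝕜 X] (M L : Submodule 𝕜 X) : Submodule 𝕜 X :=
  M ⊓ Lᗮ

/-- There are Hilbert spaces `X₁`, `X₂` and a bounded linear operator `T : X₁ → X₂` with
`I - T* T` injective and `I - T T*` onto such that `{M, N}` is unitarily equivalent to
`{Gr(-T), Gr(T)}`. -/
def HasSymmetricGraphModel {𝕜 : Type u} [RCLike 𝕜] {X : Type v} [NormedAddCommGroup X]
    [InnerProductSpace 𝕜 X] (M N : Submodule 𝕜 X) : Prop :=
  ∃ (X₁ X₂ : Type v)
    (_ : NormedAddCommGroup X₁) (_ : InnerProductSpace 𝕜 X₁) (_ : CompleteSpace X₁)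
    (_ : NormedAddCommGroup X₂) (_ : InnerProductSpace 𝕜 X₂) (_ : CompleteSpace X₂)
    (T : X₁ →L[𝕜] X₂),
    Function.Injective (ContinuousLinearMap.id 𝕜 X₁ - (ContinuousLinearMap.adjoint T).comp T) ∧
    Function.Surjective (ContinuousLinearMap.id 𝕜 X₂ - T.comp (ContinuousLinearMap.adjoint T)) ∧
    UnitarilyEquivalentPairs M N (Gr (-T)) (Gr T)

/-- The same, with `T` injective in addition. -/
def HasInjectiveSymmetricGraphModel {𝕜 : Type u} [RCLike 𝕜] {X : Type v}
    [NormedAddCommGroup X] [InnerProductSpace 𝕜 X] (M N : Submodule 𝕜 X) : Prop :=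
  ∃ (X₁ X₂ : Type v)
    (_ : NormedAddCommGroup X₁) (_ : InnerProductSpace 𝕜 X₁) (_ : CompleteSpace X₁)
    (_ : NormedAddCommGroup X₂) (_ : InnerProductSpace 𝕜 X₂) (_ : CompleteSpace X₂)
    (T : X₁ →L[𝕜] X₂),
    Function.Injective T ∧
    Function.Injective (ContinuousLinearMap.id 𝕜 X₁ - (ContinuousLinearMap.adjoint T).comp T) ∧
    Function.Surjective (ContinuousLinearMap.id 𝕜 X₂ - T.comp (ContinuousLinearMap.adjoint T)) ∧
    UnitarilyEquivalentPairs M N (Gr (-T)) (Gr T)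

/-- There are Hilbert spaces `Y₁`, `Y₂` and a bounded linear operator `S : Y₁ → Y₂` such that
`{M, N}` is unitarily equivalent to `{Y₁ ⊕ {0}, Gr(S)}`. -/
def HasOneSidedGraphModel {𝕜 : Type u} [RCLike 𝕜] {X : Type v} [NormedAddCommGroup X]
    [InnerProductSpace 𝕜 X] (M N : Submodule 𝕜 X) : Prop :=
  ∃ (Y₁ Y₂ : Type v)
    (_ : NormedAddCommGroup Y₁) (_ : InnerProductSpace 𝕜 Y₁) (_ : CompleteSpace Y₁)
    (_ : NormedAddCommGroup Y₂) (_ : InnerProductSpace 𝕜 Y₂) (_ : CompleteSpace Y₂)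
    (S : Y₁ →L[𝕜] Y₂),
    UnitarilyEquivalentPairs M N (firstSummand 𝕜 Y₁ Y₂) (Gr S)

end CommonComplement

/-! Write `p`, `q` for the orthogonal projections onto `M`, `N`. Since `M ⊕ Mᗮ = X` always,
statement 1 says `IsCompl N Mᗮ`, which holds exactly when `a = p + q - 1` is invertible. This
criterion is symmetric in `M` and `N`, hence suited to unordered pairs.

A closed complement of `Lᗮ` is the graph of a bounded operator `L → Lᗮ`. With `L = M` this gives
model 4. For model 2, `L` has to bisect the pair: from `a ^ 2 = 1 - (p - q) ^ 2` the unitary part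
`w` of the polar decomposition of `a` is a symmetry with `w p = q w`, and `L` is its fixed space
(`exists_bisector`). Then `M` is the graph of some `T` over `L`, and `N = w M` is the graph of `-T`.

The conditions on `T` restate complementarity: the kernel of `I - T*T` measures `Gr(T) ∩ Gr(-T)ᗮ`,
and the range of `I - TT*` measures the sum (`isCompl_Gr_iff`). Finally `Gr(-T) ∩ Gr(T) = ker T ⊕
0`, so injectivity of `T` means trivial intersection, and removing `M ∩ N` from both subspaces does
not affect complementarity (`isCompl_orthoDiff_iff`). -/

namespace CommonComplement

open ContinuousLinearMap Submodule

/-! ### Square roots near the identity by a contraction -/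

section SquareRoot

/-- In a Banach algebra, `1 - b` with `‖b‖ < 1` has a square root `1 - y` with `‖y‖ < 1`, and `y`
lies in every closed set that contains `0` and is stable under `x ↦ (b + x²) / 2`. -/
theorem exists_one_sub_mul_self_eq {𝕜 A : Type*} [RCLike 𝕜] [NormedRing A] [NormedAlgebra 𝕜 A]
    [CompleteSpace A] {b : A} (hb : ‖b‖ < 1) {s : Set A} (hs : IsClosed s) (h0 : (0 : A) ∈ s)
    (hmaps : ∀ x ∈ s, (2⁻¹ : 𝕜) • (b + x * x) ∈ s) :
    ∃ y ∈ s, ‖y‖ < 1 ∧ (1 - y) * (1 - y) = 1 - b := by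
  -- The equation for `y` reads `y = (b + y²) / 2`. As `‖b‖ = 2r - 1`, the ball of radius `r` is
  -- preserved because `r² ≤ 1`, and the map contracts there with constant `r`.
  set r : ℝ := (1 + ‖b‖) / 2 with hr
  have hr0 : 0 ≤ r := by positivity
  have hr1 : r < 1 := by linarith
  have h2 : ‖(2⁻¹ : 𝕜)‖ = 2⁻¹ := by simp
  let f : A → A := fun x ↦ (2⁻¹ : 𝕜) • (b + x * x)
  have hmem : ∀ x, x ∈ s ∩ Metric.closedBall 0 r ↔ x ∈ s ∧ ‖x‖ ≤ r := by simp
  have hf : Set.MapsTo f (s ∩ Metric.closedBall 0 r) (s ∩ Metric.closedBall 0 r) := by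
    intro x hx
    rw [hmem] at hx ⊢
    refine ⟨hmaps x hx.1, ?_⟩
    have h1 : ‖b + x * x‖ ≤ ‖b‖ + r * r :=
      (norm_add_le _ _).trans (by
        gcongr
        exact (norm_mul_le _ _).trans (mul_le_mul hx.2 hx.2 (norm_nonneg _) hr0))
    calc ‖f x‖ = 2⁻¹ * ‖b + x * x‖ := by rw [norm_smul, h2]
      _ ≤ 2⁻¹ * (‖b‖ + r * r) := by gcongr
      _ ≤ r := by nlinarith [norm_nonneg b]
  have hcontr : ContractingWith ⟨r, hr0⟩ (hf.restrict f _ _) := by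
    refine ⟨by exact_mod_cast hr1, LipschitzWith.of_dist_le_mul ?_⟩
    rintro ⟨x, hx⟩ ⟨z, hz⟩
    rw [hmem] at hx hz
    change dist (f x) (f z) ≤ r * dist x z
    rw [dist_eq_norm, dist_eq_norm]
    have h1 : f x - f z = (2⁻¹ : 𝕜) • (x * (x - z) + (x - z) * z) := by
      simp only [f, ← smul_sub]
      congr 1
      noncomm_ring
    rw [h1, norm_smul, h2]
    have h3 : ‖x * (x - z) + (x - z) * z‖ ≤ r * ‖x - z‖ + ‖x - z‖ * r :=
      (norm_add_le _ _).trans (add_le_add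
        ((norm_mul_le _ _).trans (by gcongr; exact hx.2))
        ((norm_mul_le _ _).trans (by gcongr; exact hz.2)))
    linarith
  obtain ⟨y, hy, hfix, -⟩ := ContractingWith.exists_fixedPoint'
    (hs.inter Metric.isClosed_closedBall).isComplete hf hcontr
    ((hmem 0).2 ⟨h0, by simpa using hr0⟩) (edist_ne_top _ _)
  rw [hmem] at hy
  refine ⟨y, hy.1, hy.2.trans_lt hr1, ?_⟩
  have h4 : b + y * y = y + y := by
    have h5 : (2⁻¹ : 𝕜) • (b + y * y) = y := hfix
    rw [← two_smul 𝕜 y]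
    nth_rw 3 [← h5]
    rw [smul_smul, mul_inv_cancel₀ two_ne_zero, one_smul]
  have h6 : (1 - y) * (1 - y) = 1 - (y + y) + y * y := by noncomm_ring
  rw [h6, ← h4]
  abel

end SquareRoot

/-! ### The bisecting projection of two projections -/

section Bisector

variable {𝕜 : Type*} [RCLike 𝕜] {X : Type*} [NormedAddCommGroup X] [InnerProductSpace 𝕜 X]
  [CompleteSpace X]

theorem norm_apply_sq_add_norm_apply_sq {p q : X →L[𝕜] X} (hp : p * p = p) (hp' : star p = p)
    (hq : q * q = q) (hq' : star q = q) (x : X) :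
    ‖(p + q - 1) x‖ ^ 2 + ‖(p - q) x‖ ^ 2 = ‖x‖ ^ 2 := by
  have key : ∀ a : X →L[𝕜] X, star a = a → ‖a x‖ ^ 2 = RCLike.re (inner 𝕜 ((a * a) x) x) := by
    intro a ha
    change _ = RCLike.re (inner 𝕜 (a (a x)) x)
    rw [← adjoint_inner_right, ← star_eq_adjoint, ha, inner_self_eq_norm_sq]
  rw [key _ (by simp [hp', hq']), key _ (by simp [hp', hq']), ← map_add, ← inner_add_left,
    ← add_apply]
  have : (p + q - 1) * (p + q - 1) + (p - q) * (p - q) = 1 := by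
    simp only [mul_add, add_mul, mul_sub, sub_mul, hp, hq, mul_one, one_mul]
    abel
  rw [this]
  exact inner_self_eq_norm_sq x

/-- An invertible `p + q - 1` is bounded below, so the Pythagorean identity above keeps `‖p - q‖`
away from `1`. -/
theorem norm_sub_mul_sub_lt_one {p q : X →L[𝕜] X} (hp : p * p = p) (hp' : star p = p)
    (hq : q * q = q) (hq' : star q = q) (h : IsUnit (p + q - 1)) :
    ‖(p - q) * (p - q)‖ < 1 := by
  obtain ⟨u, hu⟩ := h
  set v : X →L[𝕜] X := ↑u⁻¹ with hv
  have hvu : v * (p + q - 1) = 1 := by rw [← hu, hv, Units.inv_mul]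
  -- Adding `1` makes `k` positive even on the zero space, and `k ≥ 1`.
  set k : ℝ := ‖v‖ + 1 with hk
  have hk0 : 1 ≤ k := by linarith [norm_nonneg v]
  have hbound : ‖p - q‖ ≤ √(1 - (k⁻¹) ^ 2) := by
    refine opNorm_le_bound _ (Real.sqrt_nonneg _) fun x ↦ ?_
    have h1 : ‖x‖ ≤ k * ‖(p + q - 1) x‖ := by
      calc ‖x‖ = ‖(v * (p + q - 1)) x‖ := by rw [hvu]; rfl
        _ = ‖v ((p + q - 1) x)‖ := rfl
        _ ≤ ‖v‖ * ‖(p + q - 1) x‖ := le_opNorm _ _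
        _ ≤ _ := by gcongr; linarith
    have h2 : k⁻¹ * ‖x‖ ≤ ‖(p + q - 1) x‖ := by
      rw [inv_mul_le_iff₀ (by linarith)]; exact h1
    have h3 : (k⁻¹ * ‖x‖) ^ 2 ≤ ‖(p + q - 1) x‖ ^ 2 := by gcongr
    have h4 := norm_apply_sq_add_norm_apply_sq hp hp' hq hq' x
    rw [← Real.sqrt_sq (norm_nonneg x), ← Real.sqrt_mul' _ (sq_nonneg _)]
    apply Real.le_sqrt_of_sq_le
    nlinarith
  have hlt : √(1 - (k⁻¹) ^ 2) < 1 := by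
    rw [Real.sqrt_lt' one_pos]
    have : 0 < k⁻¹ := by positivity
    nlinarith
  calc ‖(p - q) * (p - q)‖ ≤ ‖p - q‖ * ‖p - q‖ := norm_mul_le _ _
    _ < 1 := by nlinarith [norm_nonneg (p - q)]

/-- Two orthogonal projections `p`, `q` with `p + q - 1` invertible have a bisector: an orthogonal
projection `f` whose reflection exchanges them, with `p + f - 1` invertible. -/
theorem exists_bisector {p q : X →L[𝕜] X} (hp : p * p = p) (hp' : star p = p)
    (hq : q * q = q) (hq' : star q = q) (h : IsUnit (p + q - 1)) :
    ∃ f : X →L[𝕜] X, f * f = f ∧ star f = f ∧ IsUnit (p + f - 1) ∧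
      (2 * f - 1) * p = q * (2 * f - 1) := by
  let b := (p - q) * (p - q)
  have hpb : Commute p b := by
    simp only [Commute, SemiconjBy, b, mul_sub, sub_mul, ← mul_assoc, hp, hq]
    simp only [mul_assoc, hp]
    abel
  have hqb : Commute q b := by
    simp only [Commute, SemiconjBy, b, mul_sub, sub_mul, ← mul_assoc, hp, hq]
    simp only [mul_assoc, hq]
    abel
  -- Membership of `y` in this closed set makes the square root self-adjoint and commuting with `p`
  -- and `q`.
  let s : Set (X →L[𝕜] X) := {x | p * x = x * p} ∩ {x | q * x = x * q} ∩ {x | star x = x}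
  have hs : IsClosed s :=
    ((isClosed_eq (by fun_prop) (by fun_prop)).inter
      (isClosed_eq (by fun_prop) (by fun_prop))).inter
      (isClosed_eq continuous_star continuous_id)
  obtain ⟨y, ⟨⟨hpy, hqy⟩, hy'⟩, hy1, hyb⟩ := exists_one_sub_mul_self_eq (𝕜 := 𝕜) (b := b)
    (norm_sub_mul_sub_lt_one hp hp' hq hq' h) hs (by simp [s]) (by
      rintro x ⟨⟨h1, h2⟩, h3⟩
      have h3' : star x = x := h3
      refine ⟨⟨?_, ?_⟩, ?_⟩
      · exact (hpb.add_right (Commute.mul_right h1 h1)).smul_right _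
      · exact (hqb.add_right (Commute.mul_right h2 h2)).smul_right _
      · simp [b, h3', hp', hq'])
  set a := p + q - 1 with ha
  have hpy : Commute p y := hpy
  have hqy : Commute q y := hqy
  have hy' : star y = y := hy'
  have haa : a * a = 1 - b := by
    simp only [ha, b, mul_add, add_mul, mul_sub, sub_mul, hp, hq, mul_one, one_mul]
    abel
  have hr : IsUnit (1 - y) := by
    rw [← isUnit_mul_self_iff, hyb, ← haa, isUnit_mul_self_iff]
    exact h
  obtain ⟨r, hr⟩ := hr
  set j : X →L[𝕜] X := ↑r⁻¹ with hj
  have hrr : (r : X →L[𝕜] X) * r = a * a := by rw [hr, hyb, haa]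
  have hpr : Commute p (r : X →L[𝕜] X) := by
    rw [hr]; exact (Commute.one_right p).sub_right hpy
  have hqr : Commute q (r : X →L[𝕜] X) := by
    rw [hr]; exact (Commute.one_right q).sub_right hqy
  have har : Commute a (r : X →L[𝕜] X) := (hpr.add_left hqr).sub_left (Commute.one_left _)
  have hpj : Commute p j := hpr.units_inv_right
  have hqj : Commute q j := hqr.units_inv_right
  have haj : Commute a j := har.units_inv_right
  have hrj : (r : X →L[𝕜] X) * j = 1 := r.mul_inv
  have hr' : star (r : X →L[𝕜] X) = r := by simp [hr, hy']
  have hj' : star j = j := by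
    have h1 : star j * r = 1 := by rw [← hr', ← star_mul, hrj, star_one]
    exact left_inv_eq_right_inv h1 hrj
  have ha' : star a = a := by simp [ha, hp', hq']
  have hap : a * p = q * a := by
    simp only [ha, mul_add, add_mul, mul_sub, sub_mul, hp, hq, mul_one, one_mul]
    abel
  -- Here `r` plays the role of `|a|` and `j` is its inverse, so `w` is the unitary part of `a`; it
  -- inherits `a p = q a`.
  set w := a * j with hw
  have hw' : star w = w := by rw [hw, star_mul, hj', ha', haj.eq]
  have hww : w * w = 1 := by
    calc w * w = a * (j * a) * j := by rw [hw]; simp only [mul_assoc]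
      _ = (a * a) * (j * j) := by rw [← haj.eq]; simp only [mul_assoc]
      _ = r * (r * j) * j := by rw [← hrr]; simp only [mul_assoc]
      _ = 1 := by rw [hrj, mul_one, hrj]
  have hwp : w * p = q * w := by
    rw [hw, mul_assoc, ← hpj.eq, ← mul_assoc, hap, mul_assoc]
  have hpw : p * w = w * q := by
    have := congrArg star hwp
    simpa [hw', hp', hq'] using this
  let f : X →L[𝕜] X := (2⁻¹ : 𝕜) • (1 + w)
  have h2f : 2 * f = 1 + w := by
    rw [two_mul, ← two_smul 𝕜 f, smul_smul, mul_inv_cancel₀ two_ne_zero, one_smul]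
  have h2f1 : 2 * f - 1 = w := by rw [h2f]; abel
  refine ⟨f, ?_, ?_, ?_, ?_⟩
  · have h1 : (1 + w) * (1 + w) = (2 : 𝕜) • (1 + w) := by
      rw [two_smul, mul_add, add_mul, add_mul, hww]
      simp only [mul_one, one_mul]
      abel
    simp only [f, smul_mul_assoc, mul_smul_comm, h1]
    rw [smul_smul (2⁻¹ : 𝕜) 2, inv_mul_cancel₀ two_ne_zero, one_smul]
  · simp [f, hw']
  · have h3 : p + f - 1 = (2⁻¹ : 𝕜) • ((p + p - 1) + w) := by
      have : (p + p - 1) + w = (2 : 𝕜) • (p + f - 1) := by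
        rw [← h2f1, two_mul, two_smul]; abel
      rw [this, smul_smul, inv_mul_cancel₀ two_ne_zero, one_smul]
    -- The sum of the two symmetries `2p - 1` and `w` has square `2 + 2r = 4(1 - y/2)`, invertible
    -- because `‖y‖ < 1`.
    have h4 : ((p + p - 1) + w) * ((p + p - 1) + w) = (2 : 𝕜) • ((2 : 𝕜) • (1 - (2⁻¹ : 𝕜) • y)) := by
      have h5 : p * w + w * p + q * w + w * q - w - w = (2 : 𝕜) • (r : X →L[𝕜] X) := by
        have : p * w + w * p + q * w + w * q - w - w = a * w + w * a := by
          rw [ha]; noncomm_ring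
        rw [this, two_smul]
        have haw : a * w = r := by
          rw [hw, ← mul_assoc, ← hrr, mul_assoc, hrj, mul_one]
        have hwa : w * a = r := by
          rw [hw, mul_assoc, ← haj.eq, ← hw, haw]
        rw [haw, hwa]
      have h6 : ((p + p - 1) + w) * ((p + p - 1) + w) =
          1 + 1 + (p * w + w * p + q * w + w * q - w - w) := by
        rw [← hwp, ← hpw]
        simp only [mul_add, add_mul, mul_sub, sub_mul, hp, hww, mul_one, one_mul]
        abel
      rw [h6, h5, hr, smul_sub, smul_sub, smul_sub, smul_smul 2 (2⁻¹ : 𝕜), mul_inv_cancel₀ two_ne_zero,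
        one_smul]
      simp only [two_smul]
      abel
    have h7 : IsUnit (1 - (2⁻¹ : 𝕜) • y) := by
      apply isUnit_one_sub_of_norm_lt_one
      rw [norm_smul]
      simp only [norm_inv, RCLike.norm_ofNat]
      linarith [norm_nonneg y]
    have hun : ∀ (c : 𝕜) (hc : c ≠ 0) (z : X →L[𝕜] X), IsUnit z → IsUnit (c • z) :=
      fun c hc z hz ↦ hz.smul (Units.mk0 c hc)
    rw [h3]
    apply hun _ (by simp)
    rw [← isUnit_mul_self_iff, h4]
    exact hun _ two_ne_zero _ (hun _ two_ne_zero _ h7)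
  · rw [h2f1, hwp]

end Bisector

/-! ### Complementarity as invertibility of `p + q - 1` -/

section Complements

variable {𝕜 : Type*} [RCLike 𝕜] {X : Type*} [NormedAddCommGroup X] [InnerProductSpace 𝕜 X]

theorem starProjection_mul_self (M : Submodule 𝕜 X) [M.HasOrthogonalProjection] :
    M.starProjection * M.starProjection = M.starProjection :=
  M.isIdempotentElem_starProjection

/-- The operator `p + q - 1 = q - (1 - p)` kills `N ∩ Mᗮ` and has range inside `N + Mᗮ`. -/
theorem isCompl_orthogonal_of_isUnit {M N : Submodule 𝕜 X} [M.HasOrthogonalProjection]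
    [N.HasOrthogonalProjection] (h : IsUnit (M.starProjection + N.starProjection - 1)) :
    IsCompl N Mᗮ := by
  obtain ⟨u, hu⟩ := h
  refine IsCompl.of_eq ?_ ?_
  · rw [Submodule.eq_bot_iff]
    rintro x ⟨hxN, hxM⟩
    have h1 : (u : X →L[𝕜] X) x = 0 := by
      rw [hu]
      change M.starProjection x + N.starProjection x - x = 0
      rw [(starProjection_apply_eq_zero_iff _).2 hxM, starProjection_eq_self_iff.2 hxN]
      simp
    calc x = ((↑u⁻¹ : X →L[𝕜] X) * (u : X →L[𝕜] X)) x := by rw [u.inv_mul]; rfl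
      _ = (↑u⁻¹ : X →L[𝕜] X) ((u : X →L[𝕜] X) x) := rfl
      _ = 0 := by rw [h1, map_zero]
  · rw [Submodule.eq_top_iff']
    intro x
    set z := (↑u⁻¹ : X →L[𝕜] X) x with hz
    have h1 : x = N.starProjection z + -(z - M.starProjection z) := by
      calc x = ((u : X →L[𝕜] X) * (↑u⁻¹ : X →L[𝕜] X)) x := by rw [u.mul_inv]; rfl
        _ = (u : X →L[𝕜] X) z := rfl
        _ = M.starProjection z + N.starProjection z - z := by rw [hu]; rfl
        _ = _ := by abel
    rw [h1]
    exact Submodule.add_mem_sup (starProjection_apply_mem _ _)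
      (Submodule.neg_mem _ (sub_starProjection_mem_orthogonal _))

variable [CompleteSpace X]

theorem star_starProjection (M : Submodule 𝕜 X) [M.HasOrthogonalProjection] :
    star M.starProjection = M.starProjection :=
  isSelfAdjoint_starProjection M

/-- The inverse is `e + e* - 1`, with `e` the oblique projection onto `N` along `Mᗮ`, bounded
because both subspaces are closed. -/
theorem isUnit_of_isCompl_orthogonal {M N : Submodule 𝕜 X} [M.HasOrthogonalProjection]
    [N.HasOrthogonalProjection] (hN : IsClosed (N : Set X)) (h : IsCompl N Mᗮ) :
    IsUnit (M.starProjection + N.starProjection - 1) := by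
  have ht : IsTopCompl N Mᗮ := h.isTopCompl_of_isClosed hN M.isClosed_orthogonal
  set p := M.starProjection with hp
  set q := N.starProjection with hq
  set e := N.projectionL Mᗮ ht with he
  have hp2 : p * p = p := starProjection_mul_self M
  have hq2 : q * q = q := starProjection_mul_self N
  have hp' : star p = p := star_starProjection M
  have hq' : star q = q := star_starProjection N
  have heq : e * q = q := by
    ext x
    exact (projectionL_eq_self_iff ht _).2 (starProjection_apply_mem N x)
  have hqe : q * e = e := by
    ext x
    exact starProjection_eq_self_iff.2 (projectionL_apply_mem ht x)
  have hep : e * p = e := by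
    ext x
    have h1 : e (x - p x) = 0 :=
      (projectionL_apply_eq_zero_iff ht).2 (sub_starProjection_mem_orthogonal x)
    rw [map_sub, sub_eq_zero] at h1
    exact h1.symm
  have hpe : p * e = p := by
    ext x
    have h1 : x - e x ∈ Mᗮ := by
      rw [he, ← projectionL_eq_self_sub_projectionL]
      exact projectionL_apply_mem ht.symm x
    have h2 : p (x - e x) = 0 := (starProjection_apply_eq_zero_iff _).2 h1
    rw [map_sub, sub_eq_zero] at h2
    exact h2.symm
  have hqe' : q * star e = q := by simpa [hq'] using congrArg star heq
  have heq' : star e * q = star e := by simpa [hq'] using congrArg star hqe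
  have hpe' : p * star e = star e := by simpa [hp'] using congrArg star hep
  have hep' : star e * p = p := by simpa [hp'] using congrArg star hpe
  refine ⟨⟨p + q - 1, e + star e - 1, ?_, ?_⟩, rfl⟩
  · simp only [add_mul, mul_add, sub_mul, mul_sub, hpe, hpe', hqe, hqe', mul_one, one_mul]
    abel
  · simp only [add_mul, mul_add, sub_mul, mul_sub, hep, hep', heq, heq', mul_one, one_mul]
    abel

theorem isCompl_orthogonal_comm {M N : Submodule 𝕜 X} (hM : IsClosed (M : Set X))
    (hN : IsClosed (N : Set X)) : IsCompl N Mᗮ ↔ IsCompl M Nᗮ := by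
  have := hM.completeSpace_coe
  have := hN.completeSpace_coe
  constructor
  · intro h
    apply isCompl_orthogonal_of_isUnit
    rw [add_comm]
    exact isUnit_of_isCompl_orthogonal hN h
  · intro h
    apply isCompl_orthogonal_of_isUnit
    rw [add_comm]
    exact isUnit_of_isCompl_orthogonal hM h

theorem isCommonComplement_orthogonal_iff {M N : Submodule 𝕜 X} (hM : IsClosed (M : Set X)) :
    IsCommonComplement Mᗮ M N ↔ IsCompl N Mᗮ := by
  have := hM.completeSpace_coe
  exact ⟨fun h ↦ h.2.2, fun h ↦ ⟨M.isClosed_orthogonal, M.isCompl_orthogonal, h⟩⟩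

/-- A closed complement of `Lᗮ` is the graph of a bounded operator from `L` to `Lᗮ`. -/
theorem exists_mem_iff_of_isCompl_orthogonal {L M : Submodule 𝕜 X} [L.HasOrthogonalProjection]
    (hM : IsClosed (M : Set X)) (h : IsCompl M Lᗮ) :
    ∃ T : L →L[𝕜] Lᗮ, ∀ x, x ∈ M ↔
      T (L.orthogonalProjectionOnto x) = Lᗮ.orthogonalProjectionOnto x := by
  have ht : IsTopCompl M Lᗮ := h.isTopCompl_of_isClosed hM L.isClosed_orthogonal
  set e := M.projectionL Lᗮ ht with he
  -- The point of `M` above `l ∈ L` is `e l`, and `T l` is its component in `Lᗮ`.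
  refine ⟨Lᗮ.orthogonalProjectionOnto ∘L e ∘L L.subtypeL, fun x ↦ ?_⟩
  have hsub : ∀ y, y - L.starProjection y ∈ Lᗮ := fun y ↦ sub_starProjection_mem_orthogonal y
  have hex : e (L.starProjection x) = e x := by
    have h1 : e (x - L.starProjection x) = 0 := (projectionL_apply_eq_zero_iff ht).2 (hsub x)
    rw [map_sub, sub_eq_zero] at h1
    exact h1.symm
  change _ ↔ Lᗮ.orthogonalProjectionOnto (e (L.starProjection x)) = _
  rw [hex]
  constructor
  · intro hx
    rw [show e x = x from (projectionL_eq_self_iff ht _).2 hx]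
  · intro hx
    have h1 : x - e x ∈ Lᗮ := by
      rw [he, ← projectionL_eq_self_sub_projectionL]
      exact projectionL_apply_mem ht.symm x
    have h2 : Lᗮ.orthogonalProjectionOnto (x - e x) = 0 := by rw [map_sub, hx, sub_self]
    have h3 : Lᗮ.starProjection (x - e x) = 0 := congrArg Subtype.val h2
    rw [starProjection_eq_self_iff.2 h1, sub_eq_zero] at h3
    rw [h3]
    exact projectionL_apply_mem ht x

end Complements

/-! ### Graphs and their orthogonal complements -/

section Graphs

variable {𝕜 : Type*} [RCLike 𝕜] {X₁ X₂ : Type*}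
  [NormedAddCommGroup X₁] [InnerProductSpace 𝕜 X₁]
  [NormedAddCommGroup X₂] [InnerProductSpace 𝕜 X₂]

theorem mem_Gr {T : X₁ →L[𝕜] X₂} {z : WithLp 2 (X₁ × X₂)} : z ∈ Gr T ↔ T z.fst = z.snd := by
  rw [eq_comm]
  rfl

theorem mem_firstSummand {z : WithLp 2 (X₁ × X₂)} : z ∈ firstSummand 𝕜 X₁ X₂ ↔ z.snd = 0 := by
  simp [firstSummand, Submodule.mem_prod]

theorem mem_firstSummand_orthogonal {z : WithLp 2 (X₁ × X₂)} :
    z ∈ (firstSummand 𝕜 X₁ X₂)ᗮ ↔ z.fst = 0 := by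
  rw [Submodule.mem_orthogonal]
  constructor
  · intro h
    have h1 := h (WithLp.toLp 2 (z.fst, 0)) (mem_firstSummand.2 rfl)
    simpa [WithLp.prod_inner_apply] using h1
  · intro h w hw
    rw [mem_firstSummand] at hw
    simp [WithLp.prod_inner_apply, h, hw]

theorem isCompl_Gr_firstSummand_orthogonal (S : X₁ →L[𝕜] X₂) :
    IsCompl (Gr S) (firstSummand 𝕜 X₁ X₂)ᗮ := by
  refine IsCompl.of_eq ?_ ?_
  · rw [Submodule.eq_bot_iff]
    rintro z ⟨h1, h2⟩
    replace h1 := mem_Gr.1 h1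
    replace h2 := mem_firstSummand_orthogonal.1 h2
    rw [h2, map_zero] at h1
    apply (WithLp.equiv 2 _).injective
    exact Prod.ext h2 h1.symm
  · rw [Submodule.eq_top_iff']
    intro z
    have : z = WithLp.toLp 2 (z.fst, S z.fst) + WithLp.toLp 2 (0, z.snd - S z.fst) := by
      apply (WithLp.equiv 2 _).injective
      exact Prod.ext (by simp) (by simp)
    rw [this]
    exact Submodule.add_mem_sup (mem_Gr.2 rfl) (mem_firstSummand_orthogonal.2 rfl)

theorem Gr_neg_inf_Gr_eq_bot_iff (T : X₁ →L[𝕜] X₂) :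
    Gr (-T) ⊓ Gr T = ⊥ ↔ Function.Injective T := by
  rw [injective_iff_map_eq_zero, Submodule.eq_bot_iff]
  constructor
  · intro h x hx
    exact congrArg WithLp.fst (h (WithLp.toLp 2 (x, 0))
      ⟨mem_Gr.2 (show -T x = 0 by rw [hx, neg_zero]), mem_Gr.2 hx⟩)
  · rintro h z ⟨h1, h2⟩
    replace h1 : -T z.fst = z.snd := mem_Gr.1 h1
    replace h2 := mem_Gr.1 h2
    have h3 : z.snd = 0 := by
      rw [h2, neg_eq_iff_add_eq_zero, ← two_smul 𝕜] at h1
      exact (smul_eq_zero_iff_right two_ne_zero).1 h1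
    rw [h3] at h2
    apply (WithLp.equiv 2 _).injective
    exact Prod.ext (h _ h2) h3

variable [CompleteSpace X₁] [CompleteSpace X₂]

theorem mem_Gr_orthogonal {T : X₁ →L[𝕜] X₂} {z : WithLp 2 (X₁ × X₂)} :
    z ∈ (Gr T)ᗮ ↔ z.fst = -(adjoint T z.snd) := by
  rw [Submodule.mem_orthogonal, eq_neg_iff_add_eq_zero]
  have key : ∀ x, inner 𝕜 (WithLp.toLp 2 (x, T x)) z = inner 𝕜 x (z.fst + adjoint T z.snd) := by
    intro x
    rw [inner_add_right, adjoint_inner_right]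
    simp [WithLp.prod_inner_apply]
  constructor
  · intro h
    have h1 := h (WithLp.toLp 2 (z.fst + adjoint T z.snd, T (z.fst + adjoint T z.snd)))
      (mem_Gr.2 rfl)
    rw [key] at h1
    exact inner_self_eq_zero.1 h1
  · intro h w hw
    have : w = WithLp.toLp 2 (w.fst, T w.fst) := by
      rw [mem_Gr.1 hw]; rfl
    rw [this, key, h, inner_zero_right]

theorem mem_Gr_neg_orthogonal {T : X₁ →L[𝕜] X₂} {z : WithLp 2 (X₁ × X₂)} :
    z ∈ (Gr (-T))ᗮ ↔ z.fst = adjoint T z.snd := by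
  rw [mem_Gr_orthogonal]
  simp

/-- Writing `(a, b) = (x, T x) + (T* y, y)` amounts to `(I - TT*) y = b - T a` with `x = a - T* y`;
a common vector is `(x, T x)` with `x = T*T x`. -/
theorem isCompl_Gr_iff (T : X₁ →L[𝕜] X₂) :
    IsCompl (Gr T) (Gr (-T))ᗮ ↔
      Function.Injective (ContinuousLinearMap.id 𝕜 X₁ - (adjoint T).comp T) ∧
      Function.Surjective (ContinuousLinearMap.id 𝕜 X₂ - T.comp (adjoint T)) := by
  constructor
  · intro h
    constructor
    · rw [injective_iff_map_eq_zero]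
      intro x hx
      have hx' : x = adjoint T (T x) := sub_eq_zero.1 hx
      have h1 : WithLp.toLp 2 (x, T x) ∈ Gr T ⊓ (Gr (-T))ᗮ :=
        ⟨mem_Gr.2 rfl, mem_Gr_neg_orthogonal.2 hx'⟩
      rw [h.inf_eq_bot, Submodule.mem_bot] at h1
      exact congrArg WithLp.fst h1
    · intro b
      have h1 : WithLp.toLp 2 ((0 : X₁), b) ∈ Gr T ⊔ (Gr (-T))ᗮ := by
        rw [h.sup_eq_top]; trivial
      obtain ⟨y, hy, z, hz, hyz⟩ := Submodule.mem_sup.1 h1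
      rw [mem_Gr] at hy
      rw [mem_Gr_neg_orthogonal] at hz
      have e1 : y.fst + z.fst = 0 := congrArg WithLp.fst hyz
      have e2 : y.snd + z.snd = b := congrArg WithLp.snd hyz
      refine ⟨z.snd, ?_⟩
      change z.snd - T (adjoint T z.snd) = b
      rw [← hz, ← e2, ← hy, eq_neg_of_add_eq_zero_left e1, map_neg]
      abel
  · rintro ⟨hinj, hsurj⟩
    rw [injective_iff_map_eq_zero] at hinj
    refine IsCompl.of_eq ?_ ?_
    · rw [Submodule.eq_bot_iff]
      rintro z ⟨h1, h2⟩
      replace h1 := mem_Gr.1 h1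
      replace h2 := mem_Gr_neg_orthogonal.1 h2
      rw [← h1] at h2
      have h3 : z.fst = 0 := hinj _ (sub_eq_zero.2 h2)
      rw [h3, map_zero] at h1
      apply (WithLp.equiv 2 _).injective
      exact Prod.ext h3 h1.symm
    · rw [Submodule.eq_top_iff']
      intro z
      obtain ⟨y, hy⟩ := hsurj (z.snd - T z.fst)
      have hy' : y - T (adjoint T y) = z.snd - T z.fst := hy
      have : z = WithLp.toLp 2 (z.fst - adjoint T y, T (z.fst - adjoint T y)) +
          WithLp.toLp 2 (adjoint T y, y) := by
        apply (WithLp.equiv 2 _).injective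
        refine Prod.ext (by simp) ?_
        change z.snd = T (z.fst - adjoint T y) + y
        rw [map_sub, sub_add_eq_add_sub, eq_sub_iff_add_eq, ← sub_eq_iff_eq_add']
        rw [add_sub_right_comm, ← hy']
        abel
      rw [this]
      exact Submodule.add_mem_sup (mem_Gr.2 rfl) (mem_Gr_neg_orthogonal.2 rfl)

end Graphs

/-! ### Invariance under unitary equivalence -/

section Transport

variable {𝕜 : Type*} [RCLike 𝕜] {X Y : Type*} [NormedAddCommGroup X] [InnerProductSpace 𝕜 X]
  [NormedAddCommGroup Y] [InnerProductSpace 𝕜 Y]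

theorem isCompl_orthogonal_map_iff (U : X ≃ₗᵢ[𝕜] Y) (M N : Submodule 𝕜 X) :
    IsCompl (N.map (U.toLinearEquiv : X →ₗ[𝕜] Y)) (M.map (U.toLinearEquiv : X →ₗ[𝕜] Y))ᗮ ↔
      IsCompl N Mᗮ := by
  rw [(Submodule.orderIsoMapComap U.toLinearEquiv).isCompl_iff (x := N) (y := Mᗮ)]
  have h : (M.map (U.toLinearEquiv : X →ₗ[𝕜] Y))ᗮ =
      Mᗮ.map (U.toLinearEquiv : X →ₗ[𝕜] Y) := (map_orthogonal_equiv M U).symm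
  rw [h]
  rfl

theorem map_inf_map_eq_bot_iff (U : X ≃ₗᵢ[𝕜] Y) (M N : Submodule 𝕜 X) :
    M.map (U.toLinearEquiv : X →ₗ[𝕜] Y) ⊓ N.map (U.toLinearEquiv : X →ₗ[𝕜] Y) = ⊥ ↔
      M ⊓ N = ⊥ := by
  rw [← Submodule.map_inf _ U.injective]
  exact map_eq_bot_iff (Submodule.orderIsoMapComap U.toLinearEquiv)

theorem UnitarilyEquivalentPairs.inf_eq_bot_iff {M N : Submodule 𝕜 X} {A B : Submodule 𝕜 Y}
    (h : UnitarilyEquivalentPairs M N A B) : M ⊓ N = ⊥ ↔ A ⊓ B = ⊥ := by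
  obtain ⟨U, ⟨rfl, rfl⟩ | ⟨rfl, rfl⟩⟩ := h
  · rw [map_inf_map_eq_bot_iff]
  · rw [map_inf_map_eq_bot_iff, inf_comm]

theorem UnitarilyEquivalentPairs.isCompl_iff [CompleteSpace X] {M N : Submodule 𝕜 X}
    {A B : Submodule 𝕜 Y} (hM : IsClosed (M : Set X)) (hN : IsClosed (N : Set X))
    (h : UnitarilyEquivalentPairs M N A B) : IsCompl N Mᗮ ↔ IsCompl B Aᗮ := by
  obtain ⟨U, ⟨rfl, rfl⟩ | ⟨rfl, rfl⟩⟩ := h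
  · rw [isCompl_orthogonal_map_iff]
  · rw [isCompl_orthogonal_map_iff, isCompl_orthogonal_comm hM hN]

theorem map_orthogonalDecomposition_eq_iff {L M : Submodule 𝕜 X} [L.HasOrthogonalProjection]
    {A : Submodule 𝕜 (WithLp 2 (L × Lᗮ))} :
    M.map (L.orthogonalDecomposition.toLinearEquiv : X →ₗ[𝕜] WithLp 2 (L × Lᗮ)) = A ↔
      ∀ x, x ∈ M ↔ L.orthogonalDecomposition x ∈ A := by
  constructor
  · rintro rfl x
    exact (L.orthogonalDecomposition.injective.mem_set_image (s := (M : Set X))).symm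
  · intro h
    ext z
    rw [Submodule.mem_map_equiv, h]
    exact iff_of_eq (congrArg (· ∈ A) (L.orthogonalDecomposition.apply_symm_apply z))

end Transport

/-! ### Existence of the graph models and removal of `M ∩ N` -/

section Models

universe u v

variable {𝕜 : Type u} [RCLike 𝕜] {X : Type v} [NormedAddCommGroup X] [InnerProductSpace 𝕜 X]
  {M N : Submodule 𝕜 X}

theorem hasInjectiveSymmetricGraphModel_iff_inf_eq_bot :
    HasInjectiveSymmetricGraphModel M N ↔ HasSymmetricGraphModel M N ∧ M ⊓ N = ⊥ := by
  constructor
  · rintro ⟨X₁, X₂, _, _, _, _, _, _, T, hT, hinj, hsurj, he⟩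
    exact ⟨⟨X₁, X₂, _, _, ‹_›, _, _, ‹_›, T, hinj, hsurj, he⟩,
      he.inf_eq_bot_iff.2 ((Gr_neg_inf_Gr_eq_bot_iff T).2 hT)⟩
  · rintro ⟨⟨X₁, X₂, _, _, _, _, _, _, T, hinj, hsurj, he⟩, hMN⟩
    exact ⟨X₁, X₂, _, _, ‹_›, _, _, ‹_›, T,
      (Gr_neg_inf_Gr_eq_bot_iff T).1 (he.inf_eq_bot_iff.1 hMN), hinj, hsurj, he⟩

theorem isClosed_orthoDiff (hM : IsClosed (M : Set X)) (K : Submodule 𝕜 X) :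
    IsClosed (orthoDiff M K : Set X) :=
  hM.inter K.isClosed_orthogonal

theorem orthoDiff_inf_orthoDiff :
    orthoDiff M (M ⊓ N) ⊓ orthoDiff N (M ⊓ N) = ⊥ := by
  rw [Submodule.eq_bot_iff]
  rintro x ⟨⟨h1, h2⟩, h3, -⟩
  exact inner_self_eq_zero.1 (h2 x ⟨h1, h3⟩)

variable [CompleteSpace X]

theorem HasSymmetricGraphModel.isCompl (hM : IsClosed (M : Set X)) (hN : IsClosed (N : Set X))
    (h : HasSymmetricGraphModel M N) : IsCompl N Mᗮ := by
  obtain ⟨X₁, X₂, _, _, _, _, _, _, T, hinj, hsurj, he⟩ := h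
  exact (he.isCompl_iff hM hN).2 ((isCompl_Gr_iff T).2 ⟨hinj, hsurj⟩)

theorem HasOneSidedGraphModel.isCompl (hM : IsClosed (M : Set X)) (hN : IsClosed (N : Set X))
    (h : HasOneSidedGraphModel M N) : IsCompl N Mᗮ := by
  obtain ⟨Y₁, Y₂, _, _, _, _, _, _, S, he⟩ := h
  exact (he.isCompl_iff hM hN).2 (isCompl_Gr_firstSummand_orthogonal S)

theorem hasOneSidedGraphModel_of_isCompl (hM : IsClosed (M : Set X)) (hN : IsClosed (N : Set X))
    (h : IsCompl N Mᗮ) : HasOneSidedGraphModel M N := by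
  have := hM.completeSpace_coe
  obtain ⟨S, hS⟩ := exists_mem_iff_of_isCompl_orthogonal hN h
  refine ⟨M, Mᗮ, inferInstance, inferInstance, inferInstance, inferInstance, inferInstance,
    inferInstance, S, M.orthogonalDecomposition, Or.inl ⟨?_, ?_⟩⟩
  · rw [map_orthogonalDecomposition_eq_iff]
    intro x
    rw [mem_firstSummand, snd_orthogonalDecomposition_apply, orthogonalProjectionOnto_eq_zero_iff,
      orthogonal_orthogonal]
  · rw [map_orthogonalDecomposition_eq_iff]
    intro x
    rw [mem_Gr, snd_orthogonalDecomposition_apply, fst_orthogonalDecomposition_apply, hS]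

theorem hasSymmetricGraphModel_of_isCompl (hM : IsClosed (M : Set X)) (hN : IsClosed (N : Set X))
    (h : IsCompl N Mᗮ) : HasSymmetricGraphModel M N := by
  have := hM.completeSpace_coe
  have := hN.completeSpace_coe
  obtain ⟨f, hf, hf', hunit, hfp⟩ := exists_bisector (starProjection_mul_self M)
    (star_starProjection M) (starProjection_mul_self N) (star_starProjection N)
    (isUnit_of_isCompl_orthogonal hN h)
  obtain ⟨L, hL, rfl⟩ : ∃ (L : Submodule 𝕜 X) (_ : L.HasOrthogonalProjection),
      L.starProjection = f := by
    have hproj : IsStarProjection f := ⟨hf, hf'⟩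
    obtain ⟨L, hL, h⟩ := isStarProjection_iff_eq_starProjection.1 hproj
    exact ⟨L, hL, h.symm⟩
  have hLc : IsClosed (L : Set X) := by
    rw [← L.orthogonal_orthogonal]
    exact isClosed_orthogonal _
  have := hLc.completeSpace_coe
  have hcompl : IsCompl M Lᗮ := by
    apply isCompl_orthogonal_of_isUnit
    rwa [add_comm]
  obtain ⟨T, hT⟩ := exists_mem_iff_of_isCompl_orthogonal hM hcompl
  -- The reflection in `L` fixes the `L` component and negates the `Lᗮ` component; since it
  -- exchanges `M` and `N`, it turns the graph of `T` into that of `-T`.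
  set w : X →L[𝕜] X := 2 * L.starProjection - 1 with hw
  have hww : w * w = 1 := by
    have : w * w = 2 * 2 * (L.starProjection * L.starProjection) - 2 * 2 * L.starProjection + 1 := by
      rw [hw]; noncomm_ring
    rw [this, hf]
    abel
  have hpw : M.starProjection * w = w * N.starProjection := by
    calc M.starProjection * w = w * (w * M.starProjection) * w := by
          rw [← mul_assoc w w, hww, one_mul]
      _ = w * N.starProjection * (w * w) := by rw [hfp]; simp only [mul_assoc]
      _ = w * N.starProjection := by rw [hww, mul_one]
  have hww_apply : ∀ x, w (w x) = x := fun x ↦ DFunLike.congr_fun hww x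
  have hwmem : ∀ x, x ∈ N ↔ w x ∈ M := by
    intro x
    rw [← starProjection_eq_self_iff (K := M), ← starProjection_eq_self_iff (K := N)]
    have h1 : M.starProjection (w x) = w (N.starProjection x) := DFunLike.congr_fun hpw x
    rw [h1]
    constructor
    · intro h2
      rw [h2]
    · intro h2
      rw [← hww_apply (N.starProjection x), h2, hww_apply]
  have hwx : ∀ x, w x = L.starProjection x + (L.starProjection x - x) := by
    intro x
    rw [hw, two_mul, add_sub_assoc]
    rfl
  have hfst : ∀ x, L.orthogonalProjectionOnto (w x) = L.orthogonalProjectionOnto x := by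
    intro x
    apply Subtype.ext
    change L.starProjection (w x) = L.starProjection x
    have h1 : L.starProjection (L.starProjection x) = L.starProjection x :=
      DFunLike.congr_fun hf x
    rw [hwx, map_add, map_sub, h1, sub_self, add_zero]
  have hsnd : ∀ x, Lᗮ.orthogonalProjectionOnto (w x) = -Lᗮ.orthogonalProjectionOnto x := by
    intro x
    have h1 : Lᗮ.orthogonalProjectionOnto (L.starProjection x) = 0 := by
      rw [orthogonalProjectionOnto_eq_zero_iff, orthogonal_orthogonal]
      exact starProjection_apply_mem L x
    rw [hwx, map_add, map_sub, h1, zero_add, zero_sub]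
  have hequiv : UnitarilyEquivalentPairs M N (Gr (-T)) (Gr T) := by
    refine ⟨L.orthogonalDecomposition, Or.inr ⟨?_, ?_⟩⟩
    · rw [map_orthogonalDecomposition_eq_iff]
      intro x
      rw [mem_Gr, snd_orthogonalDecomposition_apply, fst_orthogonalDecomposition_apply, hT]
    · rw [map_orthogonalDecomposition_eq_iff]
      intro x
      rw [mem_Gr, snd_orthogonalDecomposition_apply, fst_orthogonalDecomposition_apply, hwmem, hT,
        hfst, hsnd]
      exact neg_eq_iff_eq_neg.symm
  obtain ⟨hinj, hsurj⟩ := (isCompl_Gr_iff T).1 ((hequiv.isCompl_iff hM hN).1 h)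
  exact ⟨L, Lᗮ, inferInstance, inferInstance, inferInstance, inferInstance, inferInstance,
    inferInstance, T, hinj, hsurj, hequiv⟩

theorem hasSymmetricGraphModel_iff (hM : IsClosed (M : Set X)) (hN : IsClosed (N : Set X)) :
    HasSymmetricGraphModel M N ↔ IsCompl N Mᗮ :=
  ⟨fun h ↦ h.isCompl hM hN, hasSymmetricGraphModel_of_isCompl hM hN⟩

theorem hasOneSidedGraphModel_iff (hM : IsClosed (M : Set X)) (hN : IsClosed (N : Set X)) :
    HasOneSidedGraphModel M N ↔ IsCompl N Mᗮ :=
  ⟨fun h ↦ h.isCompl hM hN, hasOneSidedGraphModel_of_isCompl hM hN⟩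

theorem orthoDiff_sup {D : Submodule 𝕜 X} (hD : IsClosed (D : Set X)) (h : D ≤ M) :
    D ⊔ orthoDiff M D = M := by
  have := hD.completeSpace_coe
  rw [orthoDiff, inf_comm]
  exact sup_orthogonal_inf_of_hasOrthogonalProjection h

theorem orthoDiff_orthogonal {D : Submodule 𝕜 X} (hM : IsClosed (M : Set X))
    (hD : IsClosed (D : Set X)) (h : D ≤ M) : (orthoDiff M D)ᗮ = D ⊔ Mᗮ := by
  have := hD.completeSpace_coe
  have := hM.completeSpace_coe
  apply le_antisymm
  · intro x hx
    have h1 : M.starProjection x - D.starProjection x ∈ orthoDiff M D := by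
      refine ⟨M.sub_mem (starProjection_apply_mem _ _) (h (starProjection_apply_mem _ _)), ?_⟩
      have h2 : M.starProjection x - D.starProjection x =
          (x - D.starProjection x) - (x - M.starProjection x) := by abel
      rw [h2]
      exact Submodule.sub_mem _ (sub_starProjection_mem_orthogonal _)
        (orthogonal_le h (sub_starProjection_mem_orthogonal _))
    set y := M.starProjection x - D.starProjection x with hy
    have h3 : x = D.starProjection x + (x - M.starProjection x) + y := by rw [hy]; abel
    have h4 : inner 𝕜 y y = 0 := by
      have h5 : inner 𝕜 y x = 0 := hx y h1
      have h6 : inner 𝕜 y (D.starProjection x) = 0 :=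
        inner_left_of_mem_orthogonal (starProjection_apply_mem _ _) h1.2
      have h7 : inner 𝕜 y (x - M.starProjection x) = 0 :=
        inner_right_of_mem_orthogonal h1.1 (sub_starProjection_mem_orthogonal _)
      rw [h3, inner_add_right, inner_add_right, h6, h7, zero_add, zero_add] at h5
      exact h5
    rw [inner_self_eq_zero.1 h4, add_zero] at h3
    rw [h3]
    exact Submodule.add_mem_sup (starProjection_apply_mem _ _)
      (sub_starProjection_mem_orthogonal _)
  · refine sup_le ?_ (orthogonal_le inf_le_left)
    exact (le_orthogonal_orthogonal D).trans (orthogonal_le inf_le_right)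

/-- With `D = M ∩ N`, the complement of `M ⊖ D` is `D + Mᗮ`, and the extra `D` restores `N ⊖ D` to
`N`, so the sums agree. -/
theorem isCompl_orthoDiff_iff (hM : IsClosed (M : Set X)) (hN : IsClosed (N : Set X)) :
    IsCompl (orthoDiff N (M ⊓ N)) (orthoDiff M (M ⊓ N))ᗮ ↔ IsCompl N Mᗮ := by
  have hD : IsClosed ((M ⊓ N : Submodule 𝕜 X) : Set X) := hM.inter hN
  have hsup : orthoDiff N (M ⊓ N) ⊔ (orthoDiff M (M ⊓ N))ᗮ = N ⊔ Mᗮ := by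
    rw [orthoDiff_orthogonal hM hD inf_le_left, ← sup_assoc, sup_comm (orthoDiff N _),
      orthoDiff_sup hD inf_le_right]
  rw [isCompl_iff, isCompl_iff, codisjoint_iff, codisjoint_iff, hsup]
  refine and_congr_left fun _ ↦ ?_
  rw [Submodule.disjoint_def, Submodule.disjoint_def]
  constructor
  · intro h x hxN hxM
    exact h x ⟨hxN, orthogonal_le inf_le_left hxM⟩ (orthogonal_le inf_le_left hxM)
  · intro h x hxN hxM
    rw [orthoDiff_orthogonal hM hD inf_le_left] at hxM
    -- Here `m` lies in `N ∩ Mᗮ`, so it vanishes; what remains is `d`, in `D` and orthogonal to `D`.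
    obtain ⟨d, hd, m, hm, rfl⟩ := Submodule.mem_sup.1 hxM
    have hmN : m ∈ N := by
      have := N.sub_mem hxN.1 hd.2
      rwa [add_sub_cancel_left] at this
    have hm0 : m = 0 := h m hmN hm
    rw [hm0, add_zero] at hxN ⊢
    exact inner_self_eq_zero.1 (hxN.2 d hd)

end Models

end CommonComplement

theorem corollary4p6 {𝕜 : Type*} [RCLike 𝕜] {X : Type*} [NormedAddCommGroup X]
    [InnerProductSpace 𝕜 X] [CompleteSpace X] (M N : Submodule 𝕜 X)
    (hM : IsClosed (M : Set X)) (hN : IsClosed (N : Set X)) :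
    List.TFAE
      [CommonComplement.IsCommonComplement Mᗮ M N,
       CommonComplement.HasSymmetricGraphModel M N,
       CommonComplement.HasInjectiveSymmetricGraphModel
         (CommonComplement.orthoDiff M (M ⊓ N)) (CommonComplement.orthoDiff N (M ⊓ N)),
       CommonComplement.HasOneSidedGraphModel M N] ∧
    (CommonComplement.HasInjectiveSymmetricGraphModel M N ↔
      CommonComplement.IsCommonComplement Mᗮ M N ∧ M ⊓ N = ⊥) := by
  have h1 := CommonComplement.isCommonComplement_orthogonal_iff (N := N) hM
  have h2 := CommonComplement.hasSymmetricGraphModel_iff hM hN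
  have h4 := CommonComplement.hasOneSidedGraphModel_iff hM hN
  have hM₁ := CommonComplement.isClosed_orthoDiff hM (M ⊓ N)
  have hN₁ := CommonComplement.isClosed_orthoDiff hN (M ⊓ N)
  refine ⟨?_, ?_⟩
  · rw [CommonComplement.hasInjectiveSymmetricGraphModel_iff_inf_eq_bot,
      CommonComplement.hasSymmetricGraphModel_iff hM₁ hN₁,
      CommonComplement.isCompl_orthoDiff_iff hM hN,
      and_iff_left CommonComplement.orthoDiff_inf_orthoDiff, h1, h2, h4]
    tfae_have 1 ↔ 2 := Iff.rfl
    tfae_have 1 ↔ 3 := Iff.rfl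
    tfae_have 1 ↔ 4 := Iff.rfl
    tfae_finish
  · rw [CommonComplement.hasInjectiveSymmetricGraphModel_iff_inf_eq_bot, h1, h2]
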